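/- **Setting.** A ranking is a linear order of $m$ alternatives; $\mathrm{KT}(R,W)$ is the number of pairs of alternatives that $R$ and $W$ order differently. For a profile $P=(R_1,\dots,R_n)$ of rankings, $\overline{\mathrm{KT}}(P)=\frac1{n(n-1)}\sum_{i,j}\mathrm{KT}(R_i,R_j)$ (equal to $0$ if $n=1$), the sum being over ordered pairs. The Mallows distribution with central ranking $R$ and dispersion $\varphi\in(0,1]$ gives the ranking $W$ the probability $\varphi^{\mathrm{KT}(R,W)}/Z$, where $Z$ is the normalizing constant. Given a central profile $P=(R_1,\dots,R_n)$ and a dispersion vector $\vec\varphi\in(0,1]^n$, the random profile $P'$ consists of $n$ independent rankings, the $j$-th one Mallows distributed with central ranking $R_j$ and dispersion $\varphi_j$. **Algorithm.** $\mathrm{Alg}_{\mathrm{KS}}$ is the dynamic program of Betzler et al. for computing a ranking that minimizes the sum of the Kendall tau distances to the $n$ votes of a profile $V$. It computes $\bar d=\lceil\overline{\mathrm{KT}}(V)\rceil$ (if $\bar d=0$, all votes coincide and the first one is returned) and, with positions counted from $0$, the average position $p(c)$ of each alternative $c$. For $0\le i<m$ let $P_i=\{c: p(c)-\bar d<i<p(c)+\bar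 d\}$, $I_i=P_{i-1}\setminus P_i$ (for $i\ge1$) and $F_i=\bigcup_{1\le j\le i}I_j$. For an alternative $c$ and a set $B$ of alternatives let $s(c,B)$ be the number of pairs of a vote and an element $b\in B$ such that the vote prefers $b$ to $c$. Let $T(0,c,\emptyset)=s(c,\{\text{all alternatives}\}\setminus\{c\})$ for $c\in P_0$. For $i\ge1$, $c\in P_i$ and $S\subseteq P_i\setminus\{c\}$ with $|S\cup F_i|=i$ let $$T(i,c,S)=\min_{c'\in S\cup I_i}T\bigl(i-1,c',(S\cup I_i)\setminus\{c'\}\bigr)+s(c,B),$$ where $B$ is the set of the alternatives not in $S\cup F_i\cup\{c\}$; entries that are not defined this way are $+\infty$. The output is a ranking that realizes $\min_{c\in P_{m-1}}T(m-1,c,P_{m-1}\setminus\{c\})$. The running time $\mathrm{RT}(V)$ of $\mathrm{Alg}_{\mathrm{KS}}$ on $V$ is its number of elementary operations on a RAM: array accesses, arithmetic and comparisons on integers of size polynomial in $m$ and $n$, and memory allocations cost $1$ each; operations on whole sets of alternatives and accesses to entries of $T$ cost $m+1$ each. **Theorem 3 (Parameterized Typical-Case Smoothed Complexity of Kemeny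 Ranking).** There is an absolute constant $C>0$ such that the following holds for all $m\ge3$, $n\ge1$, every central profile $P$ of $n$ rankings of $m$ alternatives, every dispersion vector $\vec\varphi\in(0,1]^n$ and every $t>0$. Let $$\varphi^*=\frac1n\sum_{j=1}^n\min\Bigl(m^2\varphi_j,\ \frac{m\varphi_j}{(1-\varphi_j)^2(1-\varphi_j^2)}\Bigr),\qquad d=\bigl\lceil\overline{\mathrm{KT}}(P)+2\varphi^*+t\bigr\rceil,$$ where the second term in the minimum is $+\infty$ if $\varphi_j=1$, and let $P'$ be the random profile generated by the Mallows model from $(P,\vec\varphi)$. Then with probability at least $$1-\exp\Bigl(-\frac{2nt^2}{m^2(m-1)^2}\Bigr)$$ we have $\mathrm{RT}(P')\le C\cdot16^{d}\,d^2n^2m^2\log m$. -/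

import Mathlib

open MeasureTheory

namespace Kemeny

/-! ### Rankings, profiles, Kendall tau distance -/

/-- A ranking (linear order) of the `m` alternatives `Fin m`, given by positions:
`R a` is the position of `a`, position `0` being the best, so `a ≻ b` in `R` iff `R a < R b`. -/
abbrev Ranking (m : ℕ) : Type := Equiv.Perm (Fin m)

/-- A profile of `n` rankings. -/
abbrev Profile (m n : ℕ) : Type := Fin n → Ranking m

/-- Kendall tau distance: the number of pairs of alternatives on which `R` and `W` disagree.
A disagreeing unordered pair is counted once, as `(a, b)` with `a ≻ b` in `R`, `b ≻ a` in `W`. -/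
def kt {m : ℕ} (R W : Ranking m) : ℕ :=
  (Finset.univ.filter fun p : Fin m × Fin m => R p.1 < R p.2 ∧ W p.2 < W p.1).card

/-- Average Kendall tau distance of a profile (equal to `0` for a single ranking). -/
noncomputable def avgKT {m n : ℕ} (P : Profile m n) : ℝ :=
  (1 / ((n : ℝ) * ((n : ℝ) - 1))) * ∑ i, ∑ j, (kt (P i) (P j) : ℝ)

/-! ### The Mallows model -/

instance (m : ℕ) : MeasurableSpace (Ranking m) := ⊤

theorem kt_self {m : ℕ} (R : Ranking m) : kt R R = 0 := by
  simp only [kt, Finset.card_eq_zero, Finset.filter_eq_empty_iff]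
  intro p _ h
  exact absurd h.1 (not_lt.mpr h.2.le)

theorem mallows_weight_ne_zero {m : ℕ} (R : Ranking m) (φ : ℝ) :
    (∑' W : Ranking m, ENNReal.ofReal (φ ^ kt R W)) ≠ 0 := by
  intro h
  have := ENNReal.tsum_eq_zero.mp h R
  simp [kt_self] at this

theorem mallows_weight_ne_top {m : ℕ} (R : Ranking m) (φ : ℝ) :
    (∑' W : Ranking m, ENNReal.ofReal (φ ^ kt R W)) ≠ ⊤ := by
  rw [tsum_fintype]
  exact ENNReal.sum_ne_top.mpr fun _ _ => ENNReal.ofReal_ne_top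

/-- The Mallows distribution with central ranking `R` and dispersion `φ`: the probability of `W`
is proportional to `φ ^ kt R W`. -/
noncomputable def mallows {m : ℕ} (R : Ranking m) (φ : ℝ) : PMF (Ranking m) :=
  PMF.normalize (fun W => ENNReal.ofReal (φ ^ kt R W))
    (mallows_weight_ne_zero R φ) (mallows_weight_ne_top R φ)

/-- The law of the random profile: the rankings are independent, and ranking `j` follows the
Mallows distribution with central ranking `P j` and dispersion `φ j`. -/
noncomputable def mallowsProfile {m n : ℕ} (P : Profile m n) (φ : Fin n → ℝ) :
    Measure (Profile m n) :=
  Measure.pi fun j => (mallows (P j) (φ j)).toMeasure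

/-- `min (m² φ) (m φ / ((1 - φ)² (1 - φ²)))`, where the second term is `+∞` for `φ = 1`. -/
noncomputable def dispersionTerm (m : ℕ) (φ : ℝ) : ℝ :=
  if φ = 1 then (m : ℝ) ^ 2 * φ
  else min ((m : ℝ) ^ 2 * φ) ((m : ℝ) * φ / ((1 - φ) ^ 2 * (1 - φ ^ 2)))

/-- `φ* = (1/n) ∑ j, min (m² φ j) (m φ j / ((1 - φ j)² (1 - (φ j)²)))`. -/
noncomputable def phiStar (m : ℕ) {n : ℕ} (φ : Fin n → ℝ) : ℝ :=
  (1 / (n : ℝ)) * ∑ j, dispersionTerm m (φ j)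

/-! ### Step counting

The cost model is that of a RAM with unit-cost elementary operations (array access, assignment,
arithmetic and comparison on integers of size polynomial in `m` and `n`, memory allocation).
A set of alternatives is a bit array of length `m`: testing or changing one bit costs one
operation, every operation on whole sets costs `m + 1` operations.  The dictionary that stores
one row of the dynamic-programming table is a binary trie below an array over the alternatives,
so that an access with the key `(c, S)` costs `m + 1` operations. -/

/-- A value together with the number of elementary operations spent on computing it. -/
structure Timed (α : Type) where
  val : α
  time : ℕ

instance : Monad Timed where
  pure a := ⟨a, 0⟩
  bind x f := ⟨(f x.val).val, x.time + (f x.val).time⟩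

/-- `a`, obtained by `k` elementary operations. -/
def ops {α : Type} (k : ℕ) (a : α) : Timed α := ⟨a, k⟩

/-- The loop `for b in l do s := f s b`; each iteration costs one operation and its body. -/
def loop {β σ : Type} : List β → σ → (σ → β → Timed σ) → Timed σ
  | [], s, _ => pure s
  | b :: l, s, f => do
    let s' ← ops 1 s
    let s'' ← f s' b
    loop l s'' f

/-- All subsets of a set of alternatives. -/
def subsetList {m : ℕ} (A : Finset (Fin m)) : List (Finset (Fin m)) :=
  (((List.finRange m).filter (· ∈ A)).sublists).map List.toFinset

/-- The loop over all subsets of `A`: one scan of `A` to begin with, and `m + 1` operations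
per iteration for forming the next subset. -/
def loopSubsets {m : ℕ} {σ : Type} (A : Finset (Fin m)) (s : σ)
    (f : σ → Finset (Fin m) → Timed σ) : Timed σ := do
  let l ← ops (m + 1) (subsetList A)
  loop l s fun s S => do
    let S' ← ops (m + 1) S
    f s S'

/-- A whole-set operation. -/
def setOp {α : Type} (m : ℕ) (a : α) : Timed α := ops (m + 1) a

/-! ### The dynamic-programming algorithm of Betzler et al. -/

/-- The number of pairwise disagreements of two votes, by testing all pairs. -/
def ktTimed {m : ℕ} (u v : Ranking m) : Timed ℕ :=
  loop (List.finRange m) 0 fun s a =>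
    loop (List.finRange m) s fun s b =>
      ops 8 (if u a < u b ∧ v b < v a then s + 1 else s)

/-- The sum of the Kendall tau distances over all ordered pairs of votes. -/
def totalKT {m n : ℕ} (V : Profile m n) : Timed ℕ :=
  loop (List.finRange n) 0 fun s i =>
    loop (List.finRange n) s fun s j => do
      let k ← ktTimed (V i) (V j)
      ops 1 (s + k)

/-- The sum of the positions of an alternative in the votes, i.e. `n` times its average
position. -/
def posSum {m n : ℕ} (V : Profile m n) (c : Fin m) : Timed ℕ :=
  loop (List.finRange n) 0 fun s v => ops 2 (s + (V v c : ℕ))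

/-- The array of all position sums. -/
def posSums {m n : ℕ} (V : Profile m n) : Timed (Fin m → ℕ) :=
  loop (List.finRange m) (fun _ => 0) fun p c => do
    let x ← posSum V c
    ops 1 (Function.update p c x)

/-- The set `P_i` of the alternatives `c` with `p(c) - d < i < p(c) + d`, where
`p(c) = pos c / n` is the average position of `c`. -/
def candidatesAt {m : ℕ} (n : ℕ) (pos : Fin m → ℕ) (d i : ℕ) : Timed (Finset (Fin m)) :=
  loop (List.finRange m) ∅ fun A c =>
    ops 10 (if pos c < n * (i + d) ∧ n * i < pos c + n * d then insert c A else A)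

/-- The partial Kemeny score of `c` with respect to `B`: the number of pairs of a vote and an
element `b` of `B` such that the vote prefers `b` to `c`. -/
def partialScore {m n : ℕ} (V : Profile m n) (c : Fin m) (B : Finset (Fin m)) : Timed ℕ :=
  loop (List.finRange m) 0 fun s b => do
    let hit ← ops 1 (decide (b ∈ B))
    if hit then
      loop (List.finRange n) s fun s v => ops 4 (if V v b < V v c then s + 1 else s)
    else pure s

/-- A table entry: the score of a partial ranking, and the partial ranking itself as a linked
list, last position first. -/
abbrev Entry (m : ℕ) : Type := ℕ × List (Fin m)

/-- Row `i` of the table: the entry at `(c, S)` is for the best partial rankings with `c` at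
position `i` in which `S` is the set of the elements of `P_i` at positions smaller than `i`.
An undefined entry (value `+∞`) is `none`. -/
abbrev Row (m : ℕ) : Type := Fin m → Finset (Fin m) → Option (Entry m)

def Row.lookup {m : ℕ} (T : Row m) (c : Fin m) (S : Finset (Fin m)) : Timed (Option (Entry m)) :=
  ops (m + 1) (T c S)

def Row.store {m : ℕ} (T : Row m) (c : Fin m) (S : Finset (Fin m)) (e : Entry m) :
    Timed (Row m) :=
  ops (m + 1) fun c' S' => if c' = c ∧ S' = S then some e else T c' S'

/-- The entry with the smaller score. -/
def better {m : ℕ} : Option (Entry m) → Option (Entry m) → Option (Entry m)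
  | none, e => e
  | some e, none => some e
  | some e, some e' => if e'.1 < e.1 then some e' else some e

/-- The best entry `T (c, Q \ {c})` over all `c` in `Q`. -/
def bestEntry {m : ℕ} (T : Row m) (Q : Finset (Fin m)) : Timed (Option (Entry m)) :=
  loop (List.finRange m) none fun best c => do
    let hit ← ops 1 (decide (c ∈ Q))
    if hit then do
      let S ← setOp m (Q.erase c)
      let e ← Row.lookup T c S
      ops 4 (better best e)
    else pure best

/-- Row `0`: `T (0, c, ∅)` is the partial score of `c` with respect to all the other
alternatives, for `c` in `P_0`. -/
def firstRow {m n : ℕ} (V : Profile m n) (P0 : Finset (Fin m)) : Timed (Row m) := do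
  let T0 ← ops (m + 1) (fun _ _ => none : Row m)
  loop (List.finRange m) T0 fun T c => do
    let hit ← ops 1 (decide (c ∈ P0))
    if hit then do
      let B ← setOp m (Finset.univ.erase c)
      let x ← partialScore V c B
      Row.store T c ∅ (x, [c])
    else pure T

/-- Row `i ≥ 1` from row `i - 1`.  Here `P = P_i`, `I = P_{i-1} \ P_i`, and `F` is the union of
the sets `P_{j-1} \ P_j`, `1 ≤ j ≤ i`.  For `c ∈ P` and `S ⊆ P \ {c}` with `|S ∪ F| = i`, the
entry at `(c, S)` is the minimum of the entries of row `i - 1` at `(c', (S ∪ I) \ {c'})`,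
`c' ∈ S ∪ I`, plus the partial score of `c` with respect to the alternatives not yet placed. -/
def nextRow {m n : ℕ} (V : Profile m n) (i : ℕ) (P I F : Finset (Fin m)) (T : Row m) :
    Timed (Row m) := do
  let T0 ← ops (m + 1) (fun _ _ => none : Row m)
  loop (List.finRange m) T0 fun T' c => do
    let hit ← ops 1 (decide (c ∈ P))
    if hit then do
      let A ← setOp m (P.erase c)
      loopSubsets A T' fun T' S => do
        let U ← setOp m (S ∪ F)
        let k ← setOp m U.card
        let fits ← ops 1 (decide (k = i))
        if fits then do
          let Q ← setOp m (S ∪ I)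
          let best ← bestEntry T Q
          match best with
          | none => ops 1 T'
          | some e => do
            let U' ← setOp m (insert c U)
            let B ← setOp m U'ᶜ
            let x ← partialScore V c B
            let e' ← ops 4 (e.1 + x, c :: e.2)
            Row.store T' c S e'
        else pure T'
    else pure T'

/-- The state kept after position `i`: the row, the set `P_i`, and the set `F`. -/
structure DPState (m : ℕ) where
  row : Row m
  cur : Finset (Fin m)
  gone : Finset (Fin m)

/-- The dynamic program over the positions `0, 1, …, m - 1`; the result is the best entry
`T (m - 1, c, P_{m-1} \ {c})`. -/
def dynamicProgram {m n : ℕ} (V : Profile m n) (pos : Fin m → ℕ) (d : ℕ) :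
    Timed (Option (Entry m)) := do
  let P0 ← candidatesAt n pos d 0
  let T0 ← firstRow V P0
  let F0 ← setOp m ∅
  let s ← loop (List.range' 1 (m - 1)) (DPState.mk T0 P0 F0) fun s i => do
    let P ← candidatesAt n pos d i
    let I ← setOp m (s.cur \ P)
    let F ← setOp m (s.gone ∪ I)
    let T ← nextRow V i P I F s.row
    ops 3 (DPState.mk T P F)
  bestEntry s.row s.cur

/-- The algorithm for Kemeny Ranking; the output lists the alternatives from best to worst.
If the average Kendall tau distance is `0`, then all votes coincide and the first one is the
output.  Otherwise `d` is the average Kendall tau distance, rounded up. -/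
def algKS {m n : ℕ} (V : Profile m n) : Timed (List (Fin m)) := do
  let total ← totalKT V
  let trivial ← ops 1 (decide (total = 0))
  if trivial then
    match (List.finRange n).head? with
    | none => ops 1 []
    | some v => ops (4 * m + 2) (List.ofFn fun i => (V v).symm i)
  else do
    let d ← ops 5 ((total + n * (n - 1) - 1) / (n * (n - 1)))
    let pos ← posSums V
    let best ← dynamicProgram V pos d
    match best with
    | none => ops 1 []
    | some e => ops (2 * m + 1) e.2.reverse

/-- The number of elementary operations that the algorithm performs on the profile `V`. -/
def runtime {m n : ℕ} (V : Profile m n) : ℕ := (algKS V).time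

end Kemeny

/-!
The theorem splits into a deterministic and a probabilistic half, joined by the average Kendall tau
distance of the random profile `V`.

Deterministically, the running time is at most a constant times `16 ^ d * d² n² m²` whenever
`avgKT V ≤ d` (`runtime_le`). The exponential factor is the number of subsets of a candidate set
`P_i`, and `|P_i| ≤ 4 d` (`card_candidates_le`) because some vote is on average no farther from the
others than `d`, and a vote moves an alternative by at most its distance to another vote. The rest
is bookkeeping: the time of each loop is bounded by the number of its iterations times the time of
one of them. The factor `log m ≥ 1` is not needed.

Probabilistically, `avgKT V < avgKT P + 2 φ* + t` holds with the stated probability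
(`mallowsProfile_avgKT_lt`). By the triangle inequality, the expectation of `avgKT V` exceeds
`avgKT P` by at most twice the average of the expected distances of the votes from their central
rankings, and a vote alters `avgKT V` by at most `m (m - 1) / n`, so that the deviation is
controlled by McDiarmid's inequality (`measureReal_pi_ge_le_of_bounded_diff`), which follows from
Hoeffding's lemma by induction on the number of votes.

The expected distance of a Mallows distributed ranking from its centre is at most `m² φ` and
`m φ / (1 - φ)` (`integral_kt_mallows_le`). No formula for the normalizing constant is needed: for
each alternative `a`, exchanging `a` with a suitable alternative is an injection on the rankings
with some inversion at `a`; it removes one of these inversions and loses at least one in distance,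
hence changes the weight by a factor of at least `1 / φ` (`exists_injOn_kt_lt`).
-/

namespace Kemeny

/-! ### The Kendall tau distance -/

section KendallTau

variable {m : ℕ}

theorem kt_comm (R W : Ranking m) : kt R W = kt W R := by
  refine Finset.card_equiv (Equiv.prodComm _ _) fun p => ?_
  simp [and_comm]

theorem kt_triangle (R S W : Ranking m) : kt R W ≤ kt R S + kt S W := by
  refine (Finset.card_le_card ?_).trans (Finset.card_union_le _ _)
  rintro ⟨a, b⟩ h
  simp only [Finset.mem_union, Finset.mem_filter, Finset.mem_univ, true_and] at h ⊢
  have hab : a ≠ b := fun h' => by simp [h'] at h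
  rcases lt_or_gt_of_ne (S.injective.ne hab) with h1 | h1
  · exact .inr ⟨h1, h.2⟩
  · exact .inl ⟨h.1, h1⟩

theorem two_mul_kt_le (R W : Ranking m) : 2 * kt R W ≤ m * (m - 1) := by
  have hd : Disjoint (Finset.univ.filter fun p : Fin m × Fin m => R p.1 < R p.2 ∧ W p.2 < W p.1)
      (Finset.univ.filter fun p : Fin m × Fin m => W p.1 < W p.2 ∧ R p.2 < R p.1) := by
    rw [Finset.disjoint_filter]
    exact fun p _ h h' => absurd h.1 h'.2.asymm
  calc 2 * kt R W = kt R W + kt W R := by rw [kt_comm W R]; ring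
    _ = _ := (Finset.card_union_of_disjoint hd).symm
    _ ≤ (Finset.univ : Finset (Fin m)).offDiag.card := by
      refine Finset.card_le_card fun p hp => ?_
      simp only [Finset.mem_union, Finset.mem_filter, Finset.mem_univ, true_and,
        Finset.mem_offDiag] at hp ⊢
      rintro h
      simp [h] at hp
    _ = m * (m - 1) := by simp [Finset.offDiag_card, Nat.mul_sub]

/-- An alternative that moves by `k` positions passes at least `k` others. -/
theorem val_le_val_add_kt (R W : Ranking m) (c : Fin m) : (W c : ℕ) ≤ R c + kt R W := by
  have hcard : ∀ U : Ranking m, (Finset.univ.filter fun b => U b < U c).card = (U c : ℕ) := by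
    intro U
    rw [← Fin.card_Iio (U c)]
    exact Finset.card_equiv U (by simp)
  rw [← hcard W, ← hcard R]
  have hsub : (Finset.univ.filter fun b => W b < W c) ⊆ (Finset.univ.filter fun b => R b < R c) ∪
      (Finset.univ.filter fun b => R c < R b ∧ W b < W c) := by
    intro b
    simp only [Finset.mem_union, Finset.mem_filter, Finset.mem_univ, true_and]
    intro h
    have hbc : b ≠ c := fun h' => by simp [h'] at h
    rcases lt_or_gt_of_ne (R.injective.ne hbc) with h1 | h1
    · exact .inl h1
    · exact .inr ⟨h1, h⟩
  refine (Finset.card_le_card hsub).trans ((Finset.card_union_le _ _).trans ?_)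
  gcongr
  exact Finset.card_le_card_of_injOn (fun b => (c, b)) (by simp [Set.MapsTo]) (by simp [Set.InjOn])

/-- The alternatives ranked below `a` by `R` and above `a` by `W`. -/
def invertedWith (R W : Ranking m) (a : Fin m) : Finset (Fin m) :=
  Finset.univ.filter fun b => R a < R b ∧ W b < W a

theorem kt_eq_sum_card_invertedWith (R W : Ranking m) :
    kt R W = ∑ a, (invertedWith R W a).card := by
  simp only [kt, invertedWith, Finset.card_filter]
  rw [← Finset.univ_product_univ, Finset.sum_product]

/-- Exchanging two alternatives on which `W` disagrees with `R` brings `W` closer to `R`: a pair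
on which the new ranking disagrees with `R` either was a disagreement before, or becomes one when
its member among `a`, `b` is replaced by the other. -/
theorem kt_mul_swap_lt (R W : Ranking m) {a b : Fin m} (hR : R a < R b) (hW : W b < W a) :
    kt R (W * Equiv.swap a b) < kt R W := by
  classical
  have hab : a ≠ b := fun h => by simp [h] at hR
  have hmem : (a, b) ∈ Finset.univ.filter
      fun p : Fin m × Fin m => R p.1 < R p.2 ∧ W p.2 < W p.1 := by simp [hR, hW]
  rw [kt, kt, ← Finset.card_erase_add_one hmem, Nat.lt_succ_iff]
  have hsa : (W * Equiv.swap a b) a = W b := by simp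
  have hsb : (W * Equiv.swap a b) b = W a := by simp
  have hs : ∀ x, x ≠ a → x ≠ b → (W * Equiv.swap a b) x = W x := fun x h1 h2 => by
    simp [Equiv.swap_apply_of_ne_of_ne h1 h2]
  generalize W * Equiv.swap a b = W' at *
  have hWi : ∀ x y, W x = W y → x = y := fun x y h => W.injective h
  refine Finset.card_le_card_of_injOn
    (fun p => if W p.2 < W p.1 then p else if p.2 = a then (p.1, b) else (a, p.2)) ?_ ?_
  · rintro ⟨x, y⟩ hp
    simp only [Finset.coe_filter, Finset.mem_univ, true_and, Set.mem_ofPred_eq, Finset.coe_erase,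
      Set.mem_sdiff, Set.mem_singleton_iff] at hp ⊢
    grind (splits := 20)
  · rintro ⟨x, y⟩ hp ⟨x', y'⟩ hp'
    simp only [Finset.coe_filter, Finset.mem_univ, true_and, Set.mem_ofPred_eq] at hp hp' ⊢
    grind (splits := 20)

end KendallTau

/-! ### The expected distance under the Mallows model -/

section Mallows

variable {m : ℕ}

/-- The injection behind the Mallows estimates: `a` trades places with the lowest alternative
among those that `W` ranks above `a` against the opinion of `R`. The exchange can be undone, since
afterwards its partner is the highest alternative below `a` that `R` also ranks below `a`. -/
theorem exists_injOn_kt_lt (R : Ranking m) (a : Fin m) :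
    ∃ g : Ranking m → Ranking m,
      Set.InjOn g {W | (invertedWith R W a).Nonempty} ∧
      ∀ W, (invertedWith R W a).Nonempty → kt R (g W) < kt R W ∧
        (invertedWith R W a).card ≤ (invertedWith R (g W) a).card + 1 := by
  classical
  have hex : ∀ W : Ranking m, ∃ b, (invertedWith R W a).Nonempty →
      b ∈ invertedWith R W a ∧ ∀ c ∈ invertedWith R W a, W c ≤ W b := by
    intro W
    by_cases h : (invertedWith R W a).Nonempty
    · obtain ⟨b, hb⟩ := Finset.exists_max_image _ W h
      exact ⟨b, fun _ => hb⟩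
    · exact ⟨a, fun h' => absurd h' h⟩
  choose b hb using hex
  simp only [invertedWith, Finset.mem_filter, Finset.mem_univ, true_and] at hb
  have hswap : ∀ W c, c ≠ a → c ≠ b W → (W * Equiv.swap a (b W)) c = W c := fun W c h1 h2 => by
    simp [Equiv.swap_apply_of_ne_of_ne h1 h2]
  refine ⟨fun W => W * Equiv.swap a (b W), ?_, fun W hW => ⟨?_, ?_⟩⟩
  · have hle : ∀ W W' : Ranking m, (invertedWith R W a).Nonempty → (invertedWith R W' a).Nonempty →
        W * Equiv.swap a (b W) = W' * Equiv.swap a (b W') → W' a ≤ W a := by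
      intro W W' hW hW' h
      obtain ⟨⟨hR, hlt⟩, hmax⟩ := hb W hW
      obtain ⟨⟨hR', hlt'⟩, hmax'⟩ := hb W' hW'
      have ea : W (b W) = W' (b W') := by simpa using congrArg (· a) h
      have eb : (W' * Equiv.swap a (b W')) (b W) = W a := by simp [← h]
      by_cases hbb : b W = b W'
      · rw [hbb] at eb
        simp only [Equiv.Perm.coe_mul, Function.comp_apply, Equiv.swap_apply_right] at eb
        exact eb.le
      · rw [hswap W' _ (fun h => by simp [h] at hR) hbb] at eb
        by_contra! hcon
        have := hmax' (b W) ⟨hR, by rwa [eb]⟩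
        rw [eb, ← ea] at this
        exact absurd hlt this.not_gt
    intro W hW W' hW' h
    simp only [Set.mem_ofPred_eq] at hW hW' h
    have haa : W a = W' a := le_antisymm (hle W' W hW' hW h.symm) (hle W W' hW hW' h)
    have ebW : (W * Equiv.swap a (b W)) (b W) = W a := by simp
    have ebW' : (W * Equiv.swap a (b W)) (b W') = W a := by simp [h, haa]
    have hbb : b W = b W' := (W * Equiv.swap a (b W)).injective (ebW.trans ebW'.symm)
    rw [← hbb] at h
    exact mul_right_cancel h
  · obtain ⟨⟨hR, hlt⟩, -⟩ := hb W hW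
    exact kt_mul_swap_lt R W hR hlt
  · obtain ⟨⟨hR, hlt⟩, hmax⟩ := hb W hW
    rw [← Finset.card_erase_add_one (a := b W) (by simp [invertedWith, hR, hlt])]
    gcongr
    intro c hc
    simp only [invertedWith, Finset.mem_erase, Finset.mem_filter, Finset.mem_univ, true_and]
      at hc ⊢
    refine ⟨hc.2.1, ?_⟩
    rw [hswap W c (fun h => by simp [h] at hc) hc.1]
    have h1 : (W * Equiv.swap a (b W)) a = W (b W) := by simp
    rw [h1]
    exact lt_of_le_of_ne (hmax c hc.2) (W.injective.ne hc.1)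

/-- The exchange of `exists_injOn_kt_lt` costs a factor of at most `φ` in weight, so the
expected number of alternatives inverted with `a` is at most `φ` times the expectation of any `h`
that bounds this number in terms of its value after the exchange. -/
theorem sum_mul_pow_kt_le (R : Ranking m) (a : Fin m) {φ : ℝ} (h0 : 0 < φ) (h1 : φ ≤ 1)
    (h : ℕ → ℝ) (hnn : ∀ k, 0 ≤ h k) (hle : ∀ k l, k ≤ m → k ≤ l + 1 → (k : ℝ) ≤ h l) :
    ∑ W, ((invertedWith R W a).card : ℝ) * φ ^ kt R W
      ≤ φ * ∑ W, h (invertedWith R W a).card * φ ^ kt R W := by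
  classical
  obtain ⟨g, hinj, hg⟩ := exists_injOn_kt_lt R a
  have hcm : ∀ W, (invertedWith R W a).card ≤ m := fun W => by
    simpa using Finset.card_le_univ (invertedWith R W a)
  calc ∑ W, ((invertedWith R W a).card : ℝ) * φ ^ kt R W
      = ∑ W with (invertedWith R W a).Nonempty,
          ((invertedWith R W a).card : ℝ) * φ ^ kt R W := by
        refine (Finset.sum_filter_of_ne fun W _ hW => ?_).symm
        by_contra hne
        simp [Finset.not_nonempty_iff_eq_empty.mp hne] at hW
    _ ≤ ∑ W with (invertedWith R W a).Nonempty,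
          φ * (h (invertedWith R (g W) a).card * φ ^ kt R (g W)) := by
        refine Finset.sum_le_sum fun W hW => ?_
        obtain ⟨hlt, hcard⟩ := hg W (Finset.mem_filter.mp hW).2
        have hp : φ ^ kt R W ≤ φ * φ ^ kt R (g W) := by
          rw [← pow_succ']
          exact pow_le_pow_of_le_one h0.le h1 hlt
        calc _ ≤ h (invertedWith R (g W) a).card * (φ * φ ^ kt R (g W)) :=
              mul_le_mul (hle _ _ (hcm W) hcard) hp (by positivity) (hnn _)
          _ = _ := by ring
    _ = ∑ W ∈ (Finset.univ.filter fun W => (invertedWith R W a).Nonempty).image g,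
          φ * (h (invertedWith R W a).card * φ ^ kt R W) := by
        rw [Finset.sum_image]
        simpa using hinj
    _ ≤ ∑ W, φ * (h (invertedWith R W a).card * φ ^ kt R W) :=
        Finset.sum_le_sum_of_subset_of_nonneg (Finset.subset_univ _) fun W _ _ =>
          mul_nonneg h0.le (mul_nonneg (hnn _) (by positivity))
    _ = _ := (Finset.mul_sum _ _ _).symm

theorem integral_mallows (R : Ranking m) {φ : ℝ} (h0 : 0 < φ) (f : Ranking m → ℝ) :
    ∫ W, f W ∂(mallows R φ).toMeasure
      = (∑ W, f W * φ ^ kt R W) / ∑ W, φ ^ kt R W := by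
  rw [PMF.integral_eq_sum, Finset.sum_div]
  refine Finset.sum_congr rfl fun W _ => ?_
  rw [mallows, PMF.normalize_apply, tsum_fintype, ENNReal.toReal_mul, ENNReal.toReal_inv,
    ENNReal.toReal_sum fun _ _ => ENNReal.ofReal_ne_top]
  simp only [ENNReal.toReal_ofReal (pow_nonneg h0.le _), smul_eq_mul]
  ring

/-- For each `a`, the expected number `E a` of alternatives inverted with `a` satisfies
`E a ≤ φ m` and `E a ≤ φ (E a + 1)`; the two terms of the minimum follow by summation. -/
theorem integral_kt_mallows_le (R : Ranking m) {φ : ℝ} (h0 : 0 < φ) (h1 : φ ≤ 1) :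
    ∫ W, (kt R W : ℝ) ∂(mallows R φ).toMeasure ≤ dispersionTerm m φ := by
  set Z := ∑ W : Ranking m, φ ^ kt R W with hZ
  have hZ0 : 0 < Z := Finset.sum_pos (fun W _ => pow_pos h0 _) Finset.univ_nonempty
  set E : Fin m → ℝ := fun a => (∑ W, ((invertedWith R W a).card : ℝ) * φ ^ kt R W) / Z with hE
  have hsum : ∫ W, (kt R W : ℝ) ∂(mallows R φ).toMeasure = ∑ a, E a := by
    rw [integral_mallows R h0, hE, ← Finset.sum_div, Finset.sum_comm]
    congr 1
    refine Finset.sum_congr rfl fun W _ => ?_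
    rw [← Finset.sum_mul]
    congr 1
    exact_mod_cast kt_eq_sum_card_invertedWith R W
  have hE1 : ∀ a, E a ≤ m * φ := by
    intro a
    have := sum_mul_pow_kt_le R a h0 h1 (fun _ => (m : ℝ)) (fun _ => by positivity)
      (fun k _ hk _ => by exact_mod_cast hk)
    rw [← Finset.mul_sum, ← hZ] at this
    rw [hE, div_le_iff₀ hZ0]
    linarith
  have hE2 : ∀ a, (1 - φ) * E a ≤ φ := by
    intro a
    have := sum_mul_pow_kt_le R a h0 h1 (fun k => (k : ℝ) + 1) (fun _ => by positivity)
      (fun k l _ hk => by exact_mod_cast hk)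
    simp only [add_mul, one_mul, Finset.sum_add_distrib] at this
    rw [← hZ] at this
    have h' : E a * Z = ∑ W, ((invertedWith R W a).card : ℝ) * φ ^ kt R W :=
      div_mul_cancel₀ _ hZ0.ne'
    rw [← h'] at this
    nlinarith
  have hT1 : ∑ a, E a ≤ (m : ℝ) ^ 2 * φ := by
    refine (Finset.sum_le_sum fun a _ => hE1 a).trans_eq ?_
    simp
    ring
  rw [hsum, dispersionTerm]
  split_ifs with hφ
  · exact hT1
  · have hlt : 0 < 1 - φ := sub_pos.mpr (lt_of_le_of_ne h1 hφ)
    refine le_min hT1 ?_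
    have hle : (1 - φ) ^ 2 * (1 - φ ^ 2) ≤ 1 - φ := by
      have : (1 - φ) * (1 - φ ^ 2) ≤ 1 := by nlinarith
      nlinarith
    have hpos : 0 < (1 - φ) ^ 2 * (1 - φ ^ 2) := by
      have : 0 < 1 - φ ^ 2 := by nlinarith
      positivity
    calc ∑ a, E a ≤ ∑ _a : Fin m, φ / (1 - φ) := Finset.sum_le_sum fun a _ => by
          rw [le_div_iff₀ hlt, mul_comm]
          exact hE2 a
      _ = m * φ / (1 - φ) := by simp [mul_div_assoc]
      _ ≤ _ := div_le_div_of_nonneg_left (by positivity) hpos hle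

end Mallows

/-! ### McDiarmid's inequality -/

section BoundedDifferences

open ProbabilityTheory

/-- A function of independent variables that changes by at most `c` with each of them is
sub-Gaussian: conditionally on the first variable this holds by induction, and the conditional
expectation `g` of `f` varies by at most `c`, so that Hoeffding's lemma applies to it. -/
theorem mgf_pi_le_of_bounded_diff {Ω : Type*} [MeasurableSpace Ω]
    [DiscreteMeasurableSpace Ω] [Finite Ω] (c : ℝ) (hc : 0 ≤ c) (n : ℕ)
    (μ : Fin n → Measure Ω) [∀ i, IsProbabilityMeasure (μ i)] (f : (Fin n → Ω) → ℝ)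
    (hf : ∀ i x y, f (Function.update x i y) - f x ≤ c) (s : ℝ) :
    mgf (fun x => f x - ∫ y, f y ∂Measure.pi μ) (Measure.pi μ) s
      ≤ Real.exp (n * (c / 2) ^ 2 * s ^ 2 / 2) := by
  induction n with
  | zero =>
    have h : ∀ x, f x = f default := fun x => congrArg f (Subsingleton.elim _ _)
    simp [mgf, h]
  | succ n ih =>
    set ν := Measure.pi fun i : Fin n => μ i.succ with hν
    set g : Ω → ℝ := fun x => ∫ y, f (Fin.cons x y) ∂ν with hg
    have hmp := measurePreserving_piFinSuccAbove μ 0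
    have key : ∀ F : (Fin (n + 1) → Ω) → ℝ,
        ∫ x, F x ∂Measure.pi μ = ∫ x, ∫ y, F (Fin.cons x y) ∂ν ∂(μ 0) := by
      intro F
      rw [← (hmp.symm _).integral_comp' (g := F), integral_prod _ .of_finite]
      simp [MeasurableEquiv.piFinSuccAbove, Fin.insertNthEquiv, hν]
    have hEg : ∫ y, f y ∂Measure.pi μ = ∫ x, g x ∂(μ 0) := key f
    -- the first coordinate moves `g` by at most `c`
    have hgc : ∀ x x', g x' - g x ≤ c := by
      intro x x'
      rw [hg, ← integral_sub .of_finite .of_finite]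
      calc _ ≤ ∫ _, c ∂ν := by
            refine integral_mono .of_finite .of_finite fun y => ?_
            simpa [Fin.update_cons_zero] using hf 0 (Fin.cons x y) x'
        _ = c := by simp
    have hne : Nonempty Ω := (μ 0).nonempty_of_neZero
    obtain ⟨x₀, hx₀⟩ := Finite.exists_min g
    have hH := (hasSubgaussianMGF_of_mem_Icc (μ := μ 0) (X := g) (a := g x₀) (b := g x₀ + c)
      (Measurable.of_discrete.aemeasurable)
      (.of_forall fun x => ⟨hx₀ x, by linarith [hgc x₀ x]⟩)).mgf_le s
    have hH' : mgf (fun x => g x - ∫ x, g x ∂(μ 0)) (μ 0) s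
        ≤ Real.exp ((c / 2) ^ 2 * s ^ 2 / 2) := by
      simpa [abs_of_nonneg hc] using hH
    have hI : ∀ x, mgf (fun y => f (Fin.cons x y) - g x) ν s
        ≤ Real.exp (n * (c / 2) ^ 2 * s ^ 2 / 2) := fun x =>
      ih (fun i => μ i.succ) (fun y => f (Fin.cons x y)) fun i y z => by
        simpa [Fin.cons_update] using hf i.succ (Fin.cons x y) z
    rw [mgf, key, hEg]
    calc ∫ x, ∫ y, Real.exp (s * (f (Fin.cons x y) - ∫ x, g x ∂(μ 0))) ∂ν ∂(μ 0)
        = ∫ x, Real.exp (s * (g x - ∫ x, g x ∂(μ 0)))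
            * mgf (fun y => f (Fin.cons x y) - g x) ν s ∂(μ 0) := by
          refine integral_congr_ae (.of_forall fun x => ?_)
          simp only [mgf, ← integral_const_mul, ← Real.exp_add]
          congr! 3
          ring
      _ ≤ ∫ x, Real.exp (s * (g x - ∫ x, g x ∂(μ 0)))
            * Real.exp (n * (c / 2) ^ 2 * s ^ 2 / 2) ∂(μ 0) :=
          integral_mono .of_finite .of_finite fun x =>
            mul_le_mul_of_nonneg_left (hI x) (Real.exp_nonneg _)
      _ ≤ Real.exp ((c / 2) ^ 2 * s ^ 2 / 2) * Real.exp (n * (c / 2) ^ 2 * s ^ 2 / 2) := by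
          rw [integral_mul_const]
          exact mul_le_mul_of_nonneg_right hH' (Real.exp_nonneg _)
      _ = _ := by
          rw [← Real.exp_add]
          push_cast
          ring_nf

/-- **McDiarmid's inequality**, for finite spaces and equal bounds on the differences. -/
theorem measureReal_pi_ge_le_of_bounded_diff {Ω : Type*} [MeasurableSpace Ω]
    [DiscreteMeasurableSpace Ω] [Finite Ω] (c : ℝ) (hc : 0 ≤ c) (n : ℕ)
    (μ : Fin n → Measure Ω) [∀ i, IsProbabilityMeasure (μ i)] (f : (Fin n → Ω) → ℝ)
    (hf : ∀ i x y, f (Function.update x i y) - f x ≤ c) {t : ℝ} (ht : 0 ≤ t) :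
    (Measure.pi μ).real {x | ∫ y, f y ∂Measure.pi μ + t ≤ f x}
      ≤ Real.exp (-(2 * t ^ 2 / (n * c ^ 2))) := by
  have h : HasSubgaussianMGF (fun x => f x - ∫ y, f y ∂Measure.pi μ)
      (n * (c.toNNReal / 2) ^ 2) (Measure.pi μ) :=
    { integrable_exp_mul := fun _ => .of_finite
      mgf_le := fun s => by
        simpa [hc] using mgf_pi_le_of_bounded_diff c hc n μ f hf s }
  have h' := h.measure_ge_le ht
  simp only [le_sub_iff_add_le, add_comm t] at h'
  refine h'.trans_eq ?_
  congr 1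
  simp only [NNReal.coe_mul, NNReal.coe_natCast, NNReal.coe_pow, NNReal.coe_div,
    Real.coe_toNNReal _ hc, NNReal.coe_ofNat]
  rw [neg_div, show (2 : ℝ) * (n * (c / 2) ^ 2) = n * c ^ 2 / 2 by ring, div_div_eq_mul_div,
    mul_comm]

end BoundedDifferences

/-! ### Concentration of the average distance -/

section AverageKT

variable {m n : ℕ}

theorem kt_le_real (hm : 1 ≤ m) (R W : Ranking m) : (kt R W : ℝ) ≤ m * (m - 1) / 2 := by
  have h : ((2 * kt R W : ℕ) : ℝ) ≤ ((m * (m - 1) : ℕ) : ℝ) := by exact_mod_cast two_mul_kt_le R W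
  push_cast [Nat.cast_sub hm] at h
  linarith

/-- Replacing one vote changes the `2 (n - 1)` distances that involve it, each by at most
`m (m - 1) / 2`. -/
theorem avgKT_update_sub_le (hm : 1 ≤ m) (i : Fin n) (V : Profile m n) (W : Ranking m) :
    avgKT (Function.update V i W) - avgKT V ≤ m * (m - 1) / n := by
  have hn : 1 ≤ n := i.pos
  have hn' : (1 : ℝ) ≤ n := by exact_mod_cast hn
  have hm' : (1 : ℝ) ≤ m := by exact_mod_cast hm
  set K : ℝ := m * (m - 1) / 2 with hK
  have hK0 : 0 ≤ K := div_nonneg (mul_nonneg (by linarith) (by linarith)) (by norm_num)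
  have hterm : ∀ a b, (kt (Function.update V i W a) (Function.update V i W b) : ℝ)
      - kt (V a) (V b) ≤ K * ((if a = i then 1 else 0) + (if b = i then 1 else 0)
        - 2 * if a = i then (if b = i then 1 else 0) else 0) := by
    intro a b
    have h1 := kt_le_real hm (Function.update V i W a) (Function.update V i W b)
    have h2 : (0 : ℝ) ≤ kt (V a) (V b) := by positivity
    by_cases ha : a = i <;> by_cases hb : b = i
    · subst ha hb
      simp [kt_self]
      norm_num
    · simp only [ha, hb, if_true, if_false] at h1 h2 ⊢
      linarith
    · simp only [ha, hb, if_true, if_false] at h1 h2 ⊢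
      linarith
    · simp [ha, hb]
  have hsum : ∑ a, ∑ b, ((kt (Function.update V i W a) (Function.update V i W b) : ℝ)
      - kt (V a) (V b)) ≤ K * (2 * (n - 1)) := by
    refine (Finset.sum_le_sum fun a _ => Finset.sum_le_sum fun b _ => hterm a b).trans_eq ?_
    simp only [← Finset.mul_sum, Finset.sum_add_distrib, Finset.sum_sub_distrib]
    simp
    ring_nf
    simp
  simp only [Finset.sum_sub_distrib] at hsum
  rw [avgKT, avgKT, ← mul_sub]
  rcases eq_or_lt_of_le hn' with h | h
  · rw [← h]
    have : (0 : ℝ) ≤ m * (m - 1) := mul_nonneg (by linarith) (by linarith)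
    simpa using this
  · refine (mul_le_mul_of_nonneg_left hsum ?_).trans_eq ?_
    · exact div_nonneg zero_le_one (mul_nonneg (by linarith) (by linarith))
    · have : (n : ℝ) - 1 ≠ 0 := by linarith
      rw [hK]
      field_simp

theorem avgKT_le_avgKT_add (P V : Profile m n) :
    avgKT V ≤ avgKT P + 2 * ((1 / n) * ∑ j, (kt (P j) (V j) : ℝ)) := by
  rcases Nat.eq_zero_or_pos n with rfl | hn
  · simp [avgKT]
  have hn' : (1 : ℝ) ≤ n := by exact_mod_cast hn
  have hterm : ∀ i j, (kt (V i) (V j) : ℝ) ≤ kt (P i) (P j) + (kt (P i) (V i) + kt (P j) (V j)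
      - 2 * if i = j then (kt (P i) (V i) : ℝ) else 0) := by
    intro i j
    by_cases h : i = j
    · subst h
      simp [kt_self]
      linarith
    · have h1 := kt_triangle (V i) (P i) (V j)
      have h2 := kt_triangle (P i) (P j) (V j)
      rw [kt_comm (V i) (P i)] at h1
      have : (kt (V i) (V j) : ℝ) ≤ kt (P i) (V i) + (kt (P i) (P j) + kt (P j) (V j)) := by
        exact_mod_cast h1.trans (Nat.add_le_add_left h2 _)
      simp only [h, if_false]
      linarith
  have hsum := Finset.sum_le_sum fun i (_ : i ∈ Finset.univ) =>
    Finset.sum_le_sum fun j (_ : j ∈ Finset.univ) => hterm i j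
  simp only [← Finset.mul_sum, Finset.sum_add_distrib, Finset.sum_sub_distrib] at hsum
  simp only [Finset.sum_ite_eq, Finset.mem_univ, if_true, Finset.sum_const, Finset.card_univ,
    Fintype.card_fin, nsmul_eq_mul, ← Finset.mul_sum] at hsum
  set X := ∑ j, (kt (P j) (V j) : ℝ) with hX
  rw [avgKT, avgKT]
  rcases eq_or_lt_of_le hn' with h | h
  · rw [← h]
    have : 0 ≤ X := Finset.sum_nonneg fun j _ => by positivity
    simpa using this
  · refine (mul_le_mul_of_nonneg_left hsum ?_).trans_eq ?_
    · exact div_nonneg zero_le_one (mul_nonneg (by linarith) (by linarith))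
    · have : (n : ℝ) - 1 ≠ 0 := by linarith
      field_simp
      ring

theorem integral_avgKT_le (P : Profile m n) (φ : Fin n → ℝ) (hφ : ∀ j, 0 < φ j ∧ φ j ≤ 1) :
    ∫ V, avgKT V ∂mallowsProfile P φ ≤ avgKT P + 2 * phiStar m φ := by
  have hpr : IsProbabilityMeasure (mallowsProfile P φ) := by
    unfold mallowsProfile
    infer_instance
  refine (integral_mono .of_finite .of_finite fun V => avgKT_le_avgKT_add P V).trans ?_
  rw [integral_add .of_finite .of_finite, integral_const_mul, integral_const_mul,
    integral_finsetSum _ fun _ _ => .of_finite]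
  simp only [integral_const, probReal_univ, one_smul, phiStar]
  gcongr with j
  refine le_trans (le_of_eq ?_) (integral_kt_mallows_le (P j) (hφ j).1 (hφ j).2)
  exact integral_comp_eval (μ := fun j => (mallows (P j) (φ j)).toMeasure)
    (f := fun W => (kt (P j) W : ℝ)) Measurable.of_discrete.aestronglyMeasurable

theorem mallowsProfile_avgKT_lt (hm : 2 ≤ m) (P : Profile m n) (φ : Fin n → ℝ)
    (hφ : ∀ j, 0 < φ j ∧ φ j ≤ 1) {t : ℝ} (ht : 0 < t) :
    1 - Real.exp (-(2 * (n : ℝ) * t ^ 2 / ((m : ℝ) ^ 2 * ((m : ℝ) - 1) ^ 2)))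
      ≤ (mallowsProfile P φ).real {V | avgKT V < avgKT P + 2 * phiStar m φ + t} := by
  have hpr : IsProbabilityMeasure (mallowsProfile P φ) := by
    unfold mallowsProfile
    infer_instance
  have hm' : (2 : ℝ) ≤ m := by exact_mod_cast hm
  have hc : (0 : ℝ) ≤ m * (m - 1) / n :=
    div_nonneg (mul_nonneg (by linarith) (by linarith)) (by positivity)
  have h := measureReal_pi_ge_le_of_bounded_diff _ hc n
    (fun j => (mallows (P j) (φ j)).toMeasure) avgKT
    (fun i V W => avgKT_update_sub_le (by lia) i V W) ht.le
  have hexp : 2 * t ^ 2 / (n * ((m : ℝ) * (m - 1) / n) ^ 2)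
      = 2 * (n : ℝ) * t ^ 2 / ((m : ℝ) ^ 2 * ((m : ℝ) - 1) ^ 2) := by
    rcases Nat.eq_zero_or_pos n with rfl | hn
    · simp
    · have : (m : ℝ) - 1 ≠ 0 := by linarith
      field_simp
  rw [hexp] at h
  rw [← compl_compl {V : Profile m n | _}, probReal_compl_eq_one_sub .of_discrete]
  refine sub_le_sub_left (le_trans (measureReal_mono fun V hV => ?_) h) 1
  simp only [Set.mem_compl_iff, Set.mem_ofPred_eq, not_lt] at hV ⊢
  exact le_trans (by gcongr; exact integral_avgKT_le P φ hφ) hV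

end AverageKT

/-! ### Time and value of loops -/

section StepCounting

variable {α β σ : Type}

@[simp] theorem val_pure (a : α) : (pure a : Timed α).val = a := rfl
@[simp] theorem time_pure (a : α) : (pure a : Timed α).time = 0 := rfl
@[simp] theorem val_bind (x : Timed α) (f : α → Timed β) : (x >>= f).val = (f x.val).val := rfl
@[simp] theorem time_bind (x : Timed α) (f : α → Timed β) :
    (x >>= f).time = x.time + (f x.val).time := rfl
@[simp] theorem val_ops (k : ℕ) (a : α) : (ops k a).val = a := rfl
@[simp] theorem time_ops (k : ℕ) (a : α) : (ops k a).time = k := rfl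
@[simp] theorem val_setOp (m : ℕ) (a : α) : (setOp m a).val = a := rfl
@[simp] theorem time_setOp (m : ℕ) (a : α) : (setOp m a).time = m + 1 := rfl
@[simp] theorem time_lookup {m : ℕ} (T : Row m) (c : Fin m) (S : Finset (Fin m)) :
    (T.lookup c S).time = m + 1 := rfl
@[simp] theorem time_store {m : ℕ} (T : Row m) (c : Fin m) (S : Finset (Fin m)) (e : Entry m) :
    (T.store c S e).time = m + 1 := rfl

@[simp] theorem loop_nil (s : σ) (f : σ → β → Timed σ) : loop [] s f = pure s := rfl
@[simp] theorem val_loop_cons (b : β) (l : List β) (s : σ) (f : σ → β → Timed σ) :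
    (loop (b :: l) s f).val = (loop l (f s b).val f).val := rfl
@[simp] theorem time_loop_cons (b : β) (l : List β) (s : σ) (f : σ → β → Timed σ) :
    (loop (b :: l) s f).time = 1 + ((f s b).time + (loop l (f s b).val f).time) := rfl

/-- The time of a loop whose iterations are bounded on the states that satisfy an invariant. -/
theorem time_loop_le_and_inv {l : List β} {f : σ → β → Timed σ} (Inv : σ → Prop) (g : β → ℕ)
    (h : ∀ s, ∀ b ∈ l, Inv s → (f s b).time ≤ g b ∧ Inv (f s b).val) {s : σ} (hs : Inv s) :
    (loop l s f).time ≤ l.length + (l.map g).sum ∧ Inv (loop l s f).val := by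
  induction l generalizing s with
  | nil => simpa
  | cons b l ih =>
    obtain ⟨h1, h2⟩ := h s b (by simp) hs
    obtain ⟨h3, h4⟩ := ih (fun s c hc => h s c (by simp [hc])) h2
    simp only [time_loop_cons, val_loop_cons, List.length_cons, List.map_cons, List.sum_cons]
    exact ⟨by lia, h4⟩

theorem time_loop_le {l : List β} {f : σ → β → Timed σ} (K : ℕ)
    (h : ∀ s, ∀ b ∈ l, (f s b).time ≤ K) (s : σ) :
    (loop l s f).time ≤ l.length * (K + 1) := by
  have := (time_loop_le_and_inv (fun _ => True) (fun _ => K)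
    (fun s b hb _ => ⟨h s b hb, trivial⟩) (s := s) trivial).1
  simp only [List.map_const', List.sum_replicate, smul_eq_mul] at this
  lia

theorem time_loop_finRange_le {m : ℕ} {f : σ → Fin m → Timed σ} (K : ℕ)
    (h : ∀ s b, (f s b).time ≤ K) (s : σ) : (loop (List.finRange m) s f).time ≤ m * (K + 1) := by
  simpa using time_loop_le (l := List.finRange m) K (fun s b _ => h s b) s

/-- A scan of all alternatives that works only on the members of `A`. -/
theorem time_loop_finRange_mem_le {m : ℕ} {f : σ → Fin m → Timed σ} (A : Finset (Fin m)) (K : ℕ)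
    (h : ∀ s b, (f s b).time ≤ 1 + if b ∈ A then K else 0) (s : σ) :
    (loop (List.finRange m) s f).time ≤ 2 * m + A.card * K := by
  have := (time_loop_le_and_inv (fun _ => True) (fun b => 1 + if b ∈ A then K else 0)
    (fun s b (_ : b ∈ List.finRange m) _ => ⟨h s b, trivial⟩) (s := s) trivial).1
  rw [← Fin.sum_univ_def, Finset.sum_add_distrib] at this
  simp only [List.length_finRange, Finset.sum_const, Finset.card_univ, Fintype.card_fin,
    smul_eq_mul, mul_one, Finset.sum_ite_mem, Finset.univ_inter] at this
  lia

theorem val_loop_add {l : List β} {f : ℕ → β → Timed ℕ} (g : β → ℕ)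
    (h : ∀ s b, (f s b).val = s + g b) (s : ℕ) : (loop l s f).val = s + (l.map g).sum := by
  induction l generalizing s with
  | nil => simp
  | cons b l ih => simp [ih, h, add_assoc]

theorem val_loop_finRange_add {m : ℕ} {f : ℕ → Fin m → Timed ℕ} (g : Fin m → ℕ)
    (h : ∀ s b, (f s b).val = s + g b) (s : ℕ) :
    (loop (List.finRange m) s f).val = s + ∑ b, g b := by
  rw [val_loop_add g h, Fin.sum_univ_def]

theorem time_loopSubsets_le {m : ℕ} (A : Finset (Fin m)) (s : σ)
    (f : σ → Finset (Fin m) → Timed σ) (K : ℕ) (h : ∀ s, ∀ S ⊆ A, (f s S).time ≤ K) :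
    (loopSubsets A s f).time ≤ (m + 1) + 2 ^ A.card * (m + 2 + K) := by
  have hcard : ((List.finRange m).filter (· ∈ A)).length = A.card := by
    rw [← List.toFinset_card_of_nodup ((List.nodup_finRange m).filter _)]
    congr 1
    ext
    simp
  have hlen : (subsetList A).length = 2 ^ A.card := by
    simp [subsetList, List.length_sublists, hcard]
  have hsub : ∀ S ∈ subsetList A, S ⊆ A := by
    intro S hS c hc
    simp only [subsetList, List.mem_map, List.mem_sublists] at hS
    obtain ⟨l, hl, rfl⟩ := hS
    simpa using hl.subset (List.mem_toFinset.mp hc)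
  rw [loopSubsets, time_bind, time_ops, val_ops, ← hlen]
  gcongr
  refine (time_loop_le (m + 1 + K) (fun s S hS => ?_) s).trans_eq (by ring)
  simpa using h s S (hsub S hS)

end StepCounting

/-! ### The subroutines and the candidate sets -/

section Subroutines

variable {m n : ℕ}

theorem val_ktTimed (u v : Ranking m) : (ktTimed u v).val = kt u v := by
  rw [ktTimed, val_loop_finRange_add fun a => ∑ b, if u a < u b ∧ v b < v a then 1 else 0]
  · rw [kt, Finset.card_filter, ← Finset.univ_product_univ, Finset.sum_product, zero_add]
  · intro s a
    refine val_loop_finRange_add _ (fun s b => ?_) s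
    rw [val_ops]
    split_ifs <;> rfl

theorem time_ktTimed_le (u v : Ranking m) : (ktTimed u v).time ≤ m * (m * 9 + 1) :=
  time_loop_finRange_le _ (fun s _ => time_loop_finRange_le 8 (fun _ _ => le_rfl) s) 0

theorem val_totalKT (V : Profile m n) : (totalKT V).val = ∑ i, ∑ j, kt (V i) (V j) := by
  rw [totalKT, val_loop_finRange_add fun i => ∑ j, kt (V i) (V j), zero_add]
  exact fun s i => val_loop_finRange_add _ (fun s j => by simp [val_ktTimed]) s

theorem time_totalKT_le (V : Profile m n) :
    (totalKT V).time ≤ n * (n * (m * (m * 9 + 1) + 2) + 1) := by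
  refine time_loop_finRange_le _ (fun s i => time_loop_finRange_le _ (fun s j => ?_) s) 0
  simpa using time_ktTimed_le (V i) (V j)

theorem val_posSum (V : Profile m n) (c : Fin m) : (posSum V c).val = ∑ v, (V v c : ℕ) := by
  rw [posSum, val_loop_finRange_add (fun v => (V v c : ℕ)) (fun _ _ => rfl), zero_add]

theorem time_posSum_le (V : Profile m n) (c : Fin m) : (posSum V c).time ≤ n * 3 :=
  time_loop_finRange_le 2 (fun _ _ => le_rfl) 0

theorem val_posSums (V : Profile m n) (c : Fin m) : (posSums V).val c = ∑ v, (V v c : ℕ) := by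
  have h : ∀ (l : List (Fin m)) (p : Fin m → ℕ),
      (loop l p fun p c => do
        let x ← posSum V c
        ops 1 (Function.update p c x)).val c = if c ∈ l then ∑ v, (V v c : ℕ) else p c := by
    intro l
    induction l with
    | nil => simp
    | cons b l ih =>
      intro p
      rw [val_loop_cons, ih]
      by_cases hcb : c = b
      · subst hcb
        simp [val_posSum]
      · simp [hcb]
  rw [posSums, h]
  simp

theorem time_posSums_le (V : Profile m n) : (posSums V).time ≤ m * (n * 3 + 2) :=
  time_loop_finRange_le _ (fun _ c => by simpa using time_posSum_le V c) _

theorem val_candidatesAt (n : ℕ) (pos : Fin m → ℕ) (d i : ℕ) :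
    (candidatesAt n pos d i).val
      = Finset.univ.filter fun c => pos c < n * (i + d) ∧ n * i < pos c + n * d := by
  have h : ∀ (l : List (Fin m)) (A : Finset (Fin m)),
      (loop l A fun A c => ops 10
        (if pos c < n * (i + d) ∧ n * i < pos c + n * d then insert c A else A)).val
        = A ∪ l.toFinset.filter fun c => pos c < n * (i + d) ∧ n * i < pos c + n * d := by
    intro l
    induction l with
    | nil => simp
    | cons b l ih =>
      intro A
      rw [val_loop_cons, ih, val_ops, List.toFinset_cons, Finset.filter_insert]
      split_ifs <;> simp
  rw [candidatesAt, h]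
  simp

theorem time_candidatesAt_le (n : ℕ) (pos : Fin m → ℕ) (d i : ℕ) :
    (candidatesAt n pos d i).time ≤ m * 11 :=
  time_loop_finRange_le 10 (fun _ _ => le_rfl) _

theorem time_partialScore_le (V : Profile m n) (c : Fin m) (B : Finset (Fin m)) :
    (partialScore V c B).time ≤ 2 * m + m * (n * 5) := by
  refine (time_loop_finRange_mem_le B (n * 5) (fun s b => ?_) 0).trans ?_
  · by_cases hb : b ∈ B
    · simpa [hb] using time_loop_finRange_le 4 (fun _ _ => le_rfl) s
    · simp [hb]
  · gcongr
    simpa using Finset.card_le_univ B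

theorem time_bestEntry_le (T : Row m) (Q : Finset (Fin m)) :
    (bestEntry T Q).time ≤ 2 * m + Q.card * (2 * m + 6) := by
  refine time_loop_finRange_mem_le Q (2 * m + 6) (fun s b => ?_) none
  by_cases hb : b ∈ Q
  · simp [hb]
    lia
  · simp [hb]

theorem time_firstRow_le (V : Profile m n) (P0 : Finset (Fin m)) :
    (firstRow V P0).time ≤ (m + 1) + (2 * m + m * (4 * m + 2 + m * (n * 5))) := by
  rw [firstRow, time_bind, time_ops]
  gcongr
  refine (time_loop_finRange_mem_le P0 (4 * m + 2 + m * (n * 5)) (fun s c => ?_) _).trans ?_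
  · by_cases hc : c ∈ P0
    · have := time_partialScore_le V c (Finset.univ.erase c)
      simp [hc]
      lia
    · simp [hc]
  · gcongr
    simpa using Finset.card_le_univ P0

theorem time_nextRow_le (V : Profile m n) (i : ℕ) (P I F : Finset (Fin m)) (T : Row m) :
    (nextRow V i P I F T).time ≤ (m + 1) + (2 * m + P.card * (2 * m + 2 + 2 ^ P.card *
      (11 * m + 13 + (P.card + I.card) * (2 * m + 6) + m * (n * 5)))) := by
  rw [nextRow, time_bind, time_ops]
  gcongr
  refine time_loop_finRange_mem_le P _ (fun T' c => ?_) _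
  by_cases hc : c ∈ P
  · simp only [hc, decide_true, time_bind, time_ops, val_ops, if_true, time_setOp, val_setOp]
    have h2 : 2 ^ (P.erase c).card ≤ 2 ^ P.card :=
      Nat.pow_le_pow_right two_pos (Finset.card_le_card (Finset.erase_subset _ _))
    set K := 10 * m + 11 + (P.card + I.card) * (2 * m + 6) + m * (n * 5) with hK
    have hloop := time_loopSubsets_le (P.erase c) T' (fun T' S => do
        let U ← setOp m (S ∪ F)
        let k ← setOp m U.card
        let fits ← ops 1 (decide (k = i))
        if fits then do
          let Q ← setOp m (S ∪ I)
          let best ← bestEntry T Q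
          match best with
          | none => ops 1 T'
          | some e => do
            let U' ← setOp m (insert c U)
            let B ← setOp m U'ᶜ
            let x ← partialScore V c B
            let e' ← ops 4 (e.1 + x, c :: e.2)
            Row.store T' c S e'
        else pure T') K (fun T' S hS => by
      simp only [time_bind, time_ops, val_ops, time_setOp, val_setOp]
      by_cases hfit : (S ∪ F).card = i
      · have hQ : (S ∪ I).card ≤ P.card + I.card :=
          (Finset.card_union_le _ _).trans (Nat.add_le_add_right
            (Finset.card_le_card (hS.trans (Finset.erase_subset _ _))) _)
        have hb := (time_bestEntry_le T (S ∪ I)).trans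
          (Nat.add_le_add_left (Nat.mul_le_mul_right _ hQ) _)
        simp only [hfit, decide_true, if_true, time_bind, time_setOp, val_setOp]
        rcases (bestEntry T (S ∪ I)).val with _ | e
        · simp only [time_ops]
          lia
        · have := time_partialScore_le V c (insert c (S ∪ F))ᶜ
          simp only [time_bind, time_setOp, val_setOp, time_ops, val_ops, time_store]
          lia
      · simp only [hfit, decide_false, Bool.false_eq_true, if_false, time_pure]
        lia)
    refine (Nat.add_le_add_left (Nat.add_le_add_left hloop _) _).trans ?_
    have : 11 * m + 13 + (P.card + I.card) * (2 * m + 6) + m * (n * 5) = m + 2 + K := by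
      rw [hK]
      ring
    rw [this]
    have := Nat.mul_le_mul_right (m + 2 + K) h2
    lia
  · simp [hc]

/-- If the votes have average distance at most `d`, then at most `4 d` alternatives compete for a
position: some vote is on average within distance `d` of the votes, so it places each alternative
at most `d` away from its average position, and hence places all competitors for position `i`
less than `2 d` away from `i`. -/
theorem card_candidates_le (hn : 1 ≤ n) (V : Profile m n) (d i : ℕ)
    (hd : ∑ i, ∑ j, kt (V i) (V j) ≤ d * (n * (n - 1))) :
    (Finset.univ.filter fun c => ∑ v, (V v c : ℕ) < n * (i + d) ∧
      n * i < ∑ v, (V v c : ℕ) + n * d).card ≤ 4 * d := by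
  have hne : (Finset.univ : Finset (Fin n)).Nonempty := ⟨⟨0, hn⟩, Finset.mem_univ _⟩
  obtain ⟨v, -, hv⟩ : ∃ v ∈ Finset.univ, ∑ j, kt (V v) (V j) ≤ d * (n - 1) := by
    refine Finset.exists_le_of_sum_le hne (hd.trans_eq ?_)
    simp
    ring
  have hv' : ∑ j, kt (V v) (V j) ≤ n * d := by
    refine hv.trans ?_
    rw [mul_comm]
    gcongr
    lia
  have h1 : ∀ c, ∑ u, (V u c : ℕ) ≤ n * V v c + n * d := fun c => by
    refine (Finset.sum_le_sum fun u _ => val_le_val_add_kt (V v) (V u) c).trans ?_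
    rw [Finset.sum_add_distrib]
    simpa using hv'
  have h2 : ∀ c, n * (V v c : ℕ) ≤ ∑ u, (V u c : ℕ) + n * d := fun c => by
    have := Finset.sum_le_sum fun u (_ : u ∈ Finset.univ) => val_le_val_add_kt (V u) (V v) c
    simp only [Finset.sum_add_distrib, kt_comm _ (V v)] at this
    simp only [Finset.sum_const, Finset.card_univ, Fintype.card_fin, smul_eq_mul] at this
    lia
  calc _ ≤ (Finset.Ico (i - 2 * d) (i + 2 * d)).card := by
        refine Finset.card_le_card_of_injOn (fun c => (V v c : ℕ)) ?_ ?_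
        · intro c hc
          simp only [Finset.coe_filter, Finset.mem_univ, true_and, Set.mem_ofPred_eq] at hc
          have l1 : n * (V v c : ℕ) < n * (i + 2 * d) := by
            have := h2 c
            linarith
          have l2 : n * i < n * (V v c + 2 * d) := by
            have := h1 c
            linarith
          have := lt_of_mul_lt_mul_left l1 n.zero_le
          have := lt_of_mul_lt_mul_left l2 n.zero_le
          simp only [Finset.coe_Ico, Set.mem_Ico]
          lia
        · exact fun c _ c' _ h => (V v).injective (Fin.val_injective h)
    _ ≤ 4 * d := by
      rw [Nat.card_Ico]
      lia

end Subroutines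

/-! ### The running time of the algorithm -/

section RunningTime

variable {m n : ℕ}

/-- With at most `4 d` candidates per position, a row has at most `4 d · 2 ^ (4 d)` entries, and
filling one takes `O(d m n)` operations. -/
theorem time_nextRow_le_of_card_le (V : Profile m n) (i : ℕ) {P I : Finset (Fin m)}
    (F : Finset (Fin m)) (T : Row m) {d : ℕ} (hm : 1 ≤ m) (hn : 1 ≤ n) (hd : 1 ≤ d)
    (hP : P.card ≤ 4 * d) (hI : I.card ≤ 4 * d) :
    (nextRow V i P I F T).time ≤ 400 * (16 ^ d * (d ^ 2 * m * n)) := by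
  have h16 : 2 ^ P.card ≤ 16 ^ d := by
    calc 2 ^ P.card ≤ 2 ^ (4 * d) := Nat.pow_le_pow_right two_pos hP
      _ = 16 ^ d := by rw [pow_mul]; norm_num
  have hX : 1 ≤ 16 ^ d := Nat.one_le_pow _ _ (by norm_num)
  refine (time_nextRow_le V i P I F T).trans ?_
  generalize 16 ^ d = X at *
  have h1 : 1 ≤ d * m * n := Nat.mul_pos (Nat.mul_pos hd hm) hn
  have h2 : m ≤ d * m * n := by
    calc m = 1 * m * 1 := by ring
      _ ≤ d * m * n := by gcongr
  have h3 : m * n ≤ d * m * n := by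
    calc m * n = 1 * m * n := by ring
      _ ≤ d * m * n := by gcongr
  have h4 : d * m ≤ d * m * n := Nat.le_mul_of_pos_right _ hn
  have h5 : d ≤ d * m * n := by
    calc d = d * 1 * 1 := by ring
      _ ≤ d * m * n := by gcongr
  have h6 : d * m * n ≤ X * (d * m * n) := Nat.le_mul_of_pos_left _ hX
  have h7 : X * (d * m * n) ≤ d * (X * (d * m * n)) := Nat.le_mul_of_pos_left _ hd
  calc (m + 1) + (2 * m + P.card * (2 * m + 2 + 2 ^ P.card *
        (11 * m + 13 + (P.card + I.card) * (2 * m + 6) + m * (n * 5))))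
      ≤ (m + 1) + (2 * m + 4 * d * (2 * m + 2 + X *
        (11 * m + 13 + (4 * d + 4 * d) * (2 * m + 6) + m * (n * 5)))) := by gcongr
    _ ≤ (m + 1) + (2 * m + 4 * d * (4 * (X * (d * m * n)) + X * (93 * (d * m * n)))) := by
        gcongr
        · lia
        · linarith
    _ = (3 * m + 1) + 388 * (d * (X * (d * m * n))) := by ring
    _ ≤ 400 * (d * (X * (d * m * n))) := by lia
    _ = _ := by ring

theorem time_dynamicProgram_le (V : Profile m n) (pos : Fin m → ℕ) {d : ℕ} (hm : 1 ≤ m)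
    (hn : 1 ≤ n) (hd : 1 ≤ d) (hcard : ∀ i, (candidatesAt n pos d i).val.card ≤ 4 * d) :
    (dynamicProgram V pos d).time ≤ 600 * (16 ^ d * (d ^ 2 * m ^ 2 * n)) := by
  simp only [dynamicProgram, time_bind, time_setOp, val_setOp]
  have hloop := time_loop_le_and_inv (l := List.range' 1 (m - 1)) (σ := DPState m)
    (f := fun s i => do
      let P ← candidatesAt n pos d i
      let I ← setOp m (s.cur \ P)
      let F ← setOp m (s.gone ∪ I)
      let T ← nextRow V i P I F s.row
      ops 3 (DPState.mk T P F))
    -- the loop forgets all but the last candidate set, whose size bounds that of `P_{i-1} \ P_i`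
    (fun s => s.cur.card ≤ 4 * d)
    (fun _ => m * 11 + (2 * m + 5) + 400 * (16 ^ d * (d ^ 2 * m * n)))
    (fun s i _ hs => by
      have h1 := time_candidatesAt_le n pos d i
      have h2 := time_nextRow_le_of_card_le V i (I := s.cur \ (candidatesAt n pos d i).val)
        (s.gone ∪ (s.cur \ (candidatesAt n pos d i).val)) s.row hm hn hd (hcard i)
        ((Finset.card_le_card Finset.sdiff_subset).trans hs)
      simp only [time_bind, val_bind, time_setOp, val_setOp, time_ops, val_ops]
      exact ⟨by lia, hcard i⟩)
    (s := DPState.mk (firstRow V (candidatesAt n pos d 0).val).val (candidatesAt n pos d 0).val ∅)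
    (hcard 0)
  simp only [List.map_const', List.sum_replicate, List.length_range', smul_eq_mul] at hloop
  obtain ⟨htime, hcur⟩ := hloop
  have hbest := fun T => (time_bestEntry_le T _).trans
    (Nat.add_le_add_left (Nat.mul_le_mul_right (2 * m + 6) hcur) (2 * m))
  refine (Nat.add_le_add (time_candidatesAt_le n pos d 0) (Nat.add_le_add
    (time_firstRow_le V _) (Nat.add_le_add_left (Nat.add_le_add (htime.trans (Nat.add_le_add
      (Nat.sub_le m 1) (Nat.mul_le_mul_right _ (Nat.sub_le m 1)))) (hbest _)) _))).trans ?_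
  have hX : 1 ≤ 16 ^ d := Nat.one_le_pow _ _ (by norm_num)
  generalize 16 ^ d = X at *
  have hY : ∀ y, y ≤ d ^ 2 * m ^ 2 * n → y ≤ X * (d ^ 2 * m ^ 2 * n) := fun y hy =>
    hy.trans (Nat.le_mul_of_pos_left _ hX)
  have h0 : 1 ≤ X * (d ^ 2 * m ^ 2 * n) := hY _ (by
    calc 1 = 1 ^ 2 * 1 ^ 2 * 1 := by ring
      _ ≤ d ^ 2 * m ^ 2 * n := by gcongr)
  have h1 : m ≤ X * (d ^ 2 * m ^ 2 * n) := hY _ (by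
    calc m = 1 ^ 2 * (m * 1) * 1 := by ring
      _ ≤ d ^ 2 * (m * m) * n := by gcongr
      _ = d ^ 2 * m ^ 2 * n := by ring)
  have h2 : m ^ 2 ≤ X * (d ^ 2 * m ^ 2 * n) := hY _ (by
    calc m ^ 2 = 1 ^ 2 * m ^ 2 * 1 := by ring
      _ ≤ d ^ 2 * m ^ 2 * n := by gcongr)
  have h3 : m ^ 2 * n ≤ X * (d ^ 2 * m ^ 2 * n) := hY _ (by
    calc m ^ 2 * n = 1 ^ 2 * m ^ 2 * n := by ring
      _ ≤ d ^ 2 * m ^ 2 * n := by gcongr)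
  have h4 : d * m ≤ X * (d ^ 2 * m ^ 2 * n) := hY _ (by
    calc d * m = (d * 1) * (m * 1) * 1 := by ring
      _ ≤ (d * d) * (m * m) * n := by gcongr
      _ = d ^ 2 * m ^ 2 * n := by ring)
  have h5 : d ≤ X * (d ^ 2 * m ^ 2 * n) := hY _ (by
    calc d = (d * 1) * (1 * 1) * 1 := by ring
      _ ≤ (d * d) * (m * m) * n := by gcongr
      _ = d ^ 2 * m ^ 2 * n := by ring)
  linarith

/-- The running time is governed by any upper bound `d ≥ 1` on the average distance of the votes. -/
theorem runtime_le (V : Profile m n) {d : ℕ} (hm : 1 ≤ m) (hn : 1 ≤ n) (hd : 1 ≤ d)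
    (hV : avgKT V ≤ d) : runtime V ≤ 1000 * (16 ^ d * (d ^ 2 * n ^ 2 * m ^ 2)) := by
  have hbase : n ^ 2 * m ^ 2 ≤ 16 ^ d * (d ^ 2 * n ^ 2 * m ^ 2) := by
    calc n ^ 2 * m ^ 2 = 1 * (1 ^ 2 * n ^ 2 * m ^ 2) := by ring
      _ ≤ 16 ^ d * (d ^ 2 * n ^ 2 * m ^ 2) := by
        gcongr
        exact Nat.one_le_pow _ _ (by norm_num)
  have hn2 : n ≤ n ^ 2 := Nat.le_self_pow two_ne_zero n
  have hm2 : m ≤ m ^ 2 := Nat.le_self_pow two_ne_zero m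
  have hY0 : 1 ≤ n ^ 2 * m ^ 2 := Nat.mul_pos (by positivity) (by positivity)
  have hYm : m ≤ n ^ 2 * m ^ 2 := by
    calc m = 1 * m := by ring
      _ ≤ n ^ 2 * m ^ 2 := by gcongr; lia
  have hYnm : n * m ≤ n ^ 2 * m ^ 2 := by gcongr
  have hYn : n ≤ n ^ 2 * m ^ 2 := (Nat.le_mul_of_pos_right n hm).trans hYnm
  have hYn2 : n ^ 2 ≤ n ^ 2 * m ^ 2 := Nat.le_mul_of_pos_right _ (by positivity)
  have hYn2m : n ^ 2 * m ≤ n ^ 2 * m ^ 2 := by gcongr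
  have htot : (totalKT V).time ≤ 13 * (n ^ 2 * m ^ 2) := by
    refine (time_totalKT_le V).trans ?_
    linarith
  simp only [runtime, algKS, time_bind, time_ops, val_ops]
  -- the main branch is entered only if `n ≥ 2`, so the divisor `n (n - 1)` of the rounded average
  -- is not zero there
  by_cases h0 : (totalKT V).val = 0
  · simp only [h0, decide_true, if_true]
    rcases (List.finRange n).head? with _ | v
    · simp only [time_ops]
      lia
    · simp only [time_ops]
      lia
  · simp only [h0, decide_false, Bool.false_eq_true, if_false, time_bind, time_ops, val_ops]
    set N := n * (n - 1) with hN
    have hN0 : 0 < N := by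
      rw [Nat.pos_iff_ne_zero]
      intro h
      have hn1 : n = 1 := by
        rcases Nat.mul_eq_zero.mp (hN ▸ h) with h | h <;> lia
      subst hn1
      simp [val_totalKT, kt_self] at h0
    set D := ((totalKT V).val + N - 1) / N with hD
    have hDtot : (totalKT V).val ≤ D * N := by
      have := Nat.lt_div_mul_add hN0 (a := (totalKT V).val + N - 1)
      rw [← hD] at this
      lia
    have hD1 : 1 ≤ D := by
      rw [hD, Nat.le_div_iff_mul_le hN0]
      lia
    have hDd : D ≤ d := by
      have hle : (totalKT V).val ≤ d * N := by
        have hNr : (N : ℝ) = n * (n - 1) := by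
          rw [hN]
          push_cast [Nat.cast_sub hn]
          ring
        have hNr0 : (0 : ℝ) < N := by exact_mod_cast hN0
        rw [avgKT, ← hNr, one_div, inv_mul_le_iff₀ hNr0] at hV
        rw [val_totalKT, mul_comm d]
        exact_mod_cast hV
      rw [hD, ← Nat.lt_succ_iff, Nat.div_lt_iff_lt_mul hN0]
      rw [Nat.succ_mul]
      lia
    have hdp := time_dynamicProgram_le V (posSums V).val hm hn hD1 fun i => by
      rw [val_candidatesAt]
      simp only [val_posSums]
      exact card_candidates_le hn V D i (by rw [← val_totalKT]; exact hDtot)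
    have hdp' : (dynamicProgram V (posSums V).val D).time
        ≤ 600 * (16 ^ d * (d ^ 2 * n ^ 2 * m ^ 2)) := by
      refine hdp.trans ?_
      calc 600 * (16 ^ D * (D ^ 2 * m ^ 2 * n))
          ≤ 600 * (16 ^ d * (d ^ 2 * m ^ 2 * n ^ 2)) := by gcongr; norm_num
        _ = _ := by ring
    have hpos := time_posSums_le V
    have hpos' : m * (n * 3 + 2) ≤ 5 * (n ^ 2 * m ^ 2) := by linarith
    rcases (dynamicProgram V (posSums V).val D).val with _ | e
    · simp only [time_ops]
      lia
    · simp only [time_ops]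
      lia

end RunningTime

end Kemeny

theorem theorem3 :
    ∃ C : ℝ, 0 < C ∧
      ∀ (m n : ℕ), 3 ≤ m → 1 ≤ n →
      ∀ (P : Kemeny.Profile m n) (φ : Fin n → ℝ), (∀ j, 0 < φ j ∧ φ j ≤ 1) →
      ∀ t : ℝ, 0 < t →
      ∀ d : ℕ, d = ⌈Kemeny.avgKT P + 2 * Kemeny.phiStar m φ + t⌉₊ →
        1 - Real.exp (-(2 * (n : ℝ) * t ^ 2 / ((m : ℝ) ^ 2 * ((m : ℝ) - 1) ^ 2))) ≤
          (Kemeny.mallowsProfile P φ).real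
            {P' : Kemeny.Profile m n |
              (Kemeny.runtime P' : ℝ) ≤
                C * ((16 : ℝ) ^ d *
                  ((d : ℝ) ^ 2 * (n : ℝ) ^ 2 * (m : ℝ) ^ 2 * Real.log (m : ℝ)))} := by
  refine ⟨1000, by norm_num, ?_⟩
  intro m n hm hn P φ hφ t ht d hd
  have hpr : IsProbabilityMeasure (Kemeny.mallowsProfile P φ) := by
    unfold Kemeny.mallowsProfile
    infer_instance
  refine (Kemeny.mallowsProfile_avgKT_lt (by lia) P φ hφ ht).trans (measureReal_mono ?_)
  intro V hV
  simp only [Set.mem_ofPred_eq] at hV ⊢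
  have hnonneg : 0 ≤ Kemeny.avgKT V := by
    have : (1 : ℝ) ≤ n := by exact_mod_cast hn
    exact mul_nonneg (div_nonneg zero_le_one (mul_nonneg (by linarith) (by linarith)))
      (by positivity)
  have hd1 : 1 ≤ d := by
    rw [hd, Nat.one_le_ceil_iff]
    exact hnonneg.trans_lt hV
  have hVd : Kemeny.avgKT V ≤ d := by
    rw [hd]
    exact hV.le.trans (Nat.le_ceil _)
  have hlog : 1 ≤ Real.log m := by
    have hm' : (3 : ℝ) ≤ m := by exact_mod_cast hm
    rw [Real.le_log_iff_exp_le (by linarith)]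
    linarith [Real.exp_one_lt_d9]
  have h : (Kemeny.runtime V : ℝ) ≤ 1000 * (16 ^ d * (d ^ 2 * n ^ 2 * m ^ 2)) := by
    exact_mod_cast Kemeny.runtime_le V (by lia) hn hd1 hVd
  refine h.trans ?_
  exact mul_le_mul_of_nonneg_left (mul_le_mul_of_nonneg_left
    (le_mul_of_one_le_right (by positivity) hlog) (by positivity)) (by norm_num)
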